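/- Let $\mathbb F_q$ be a finite field, let $M\ge 1$ and $1\le K\le N$, and let $\mathbf G=[\mathbf g_1\ \cdots\ \mathbf g_N]\in\mathbb F_q^{K\times N}$ generate an $(N,K)$ MDS code, i.e. any $K$ columns of $\mathbf G$ are linearly independent; put $R_c=K/N$. Each message $W_m$, $m\in[1:M]$, consists of $L=\tilde L K$ symbols, arranged as $\tilde L$ segments $\mathbf w_{m,t}\in\mathbb F_q^K$; all symbols of all messages are independent and uniform on $\mathbb F_q$. Database $n\in[1:N]$ stores $\mathbf W_{DB_n}=(\mathbf g_n^T\mathbf w_{m,t})_{m,t}$. Let $\mathbf v_1,\dots,\mathbf v_V\in\mathbb F_q^M$, $V=\frac{q^M-1}{q-1}$, be nonzero and pairwise non-proportional, and let $\widetilde W_\nu=\sum_m v_\nu(m)W_m$. A private function retrieval scheme works as follows. The user, who wants $\widetilde W_\nu$, computes queries $Q_1^{[\nu]},\dots,Q_N^{[\nu]}$ from $\nu$ and from private randomness that is independent of the messages, so that $I(Q_{1:N}^{[\nu]};W_{1:M})=0$. Database $n$ returns an answer $A_n^{[\nu]}$ that is a deterministic function of $Q_n^{[\nu]}$ and $\mathbf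 W_{DB_n}$, so that $H(A_n^{[\nu]}\mid Q_n^{[\nu]},\mathbf W_{DB_n})=0$. The user estimates $\widetilde W_\nu$ from all answers and queries. The scheme is private if $I(A_n^{[\nu]},Q_n^{[\nu]},\mathbf W_{DB_n};\nu)=0$ for every $n$ and every distribution of the index $\nu$, taken independent of the messages and of the private randomness. For each $\nu$, its rate is $H(\widetilde W_\nu)/\sum_{n=1}^N H(A_n^{[\nu]})$. A number $R$ is an achievable rate if there is a sequence of private schemes with $L\to\infty$, each of rate at least $R$ for every $\nu$, such that for every $\nu$ the probability of decoding $\widetilde W_\nu$ incorrectly tends to $0$ and $H(\widetilde W_\nu\mid A_{1:N}^{[\nu]},Q_{1:N}^{[\nu]})=o(L)$. Theorem. Every $$R\le\bigl(1+R_c+R_c^2+\dots+R_c^{M-1}\bigr)^{-1}$$ is achievable. If $K<N$, the right-hand side equals $\dfrac{1-R_c}{1-R_c^M}$. -/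

import Mathlib

open Filter Topology Asymptotics

universe u

noncomputable section

/-! ### Shannon quantities of random variables on a finite sample space

A sample space is a finite type `Ω` with a weight function `p : Ω → ℝ`, a random variable is a
function on `Ω`.  Logarithms are natural; the base cancels in every rate. -/

/-- The probability of the event `X = x`. -/
def prob {Ω : Type*} {α : Type*} [Fintype Ω] (p : Ω → ℝ) (X : Ω → α) (x : α) : ℝ :=
  open Classical in ∑ ω with X ω = x, p ω

/-- The Shannon entropy `H(X) = -∑ P(X = x) log P(X = x)`, summed over the range of `X`. -/
def entropy {Ω : Type*} {α : Type*} [Fintype Ω] (p : Ω → ℝ) (X : Ω → α) : ℝ :=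
  open Classical in ∑ x ∈ Finset.univ.image X, Real.negMulLog (prob p X x)

/-- The conditional entropy `H(X | Y) = H(X, Y) - H(Y)`. -/
def condEntropy {Ω : Type*} {α β : Type*} [Fintype Ω] (p : Ω → ℝ) (X : Ω → α) (Y : Ω → β) : ℝ :=
  entropy p (fun ω => (X ω, Y ω)) - entropy p Y

/-- The mutual information `I(X; Y) = H(X) + H(Y) - H(X, Y)`. -/
def mutualInfo {Ω : Type*} {α β : Type*} [Fintype Ω] (p : Ω → ℝ) (X : Ω → α) (Y : Ω → β) : ℝ :=
  entropy p X + entropy p Y - entropy p (fun ω => (X ω, Y ω))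

/-! ### MDS coded storage and linear combinations -/

/-- `G` generates an `(N, K)` MDS code: any `K` of its `N` columns are linearly independent. -/
def IsMDS {F : Type u} [Field F] {K N : ℕ} (G : Matrix (Fin K) (Fin N) F) : Prop :=
  ∀ s : Finset (Fin N), s.card = K → LinearIndependent F (fun n : s => fun k => G k n)

/-- `M` messages; each consists of `Lt` segments of `K` symbols, so it has length `L = Lt * K`. -/
abbrev Messages (F : Type u) (M Lt K : ℕ) : Type u := Fin M → Fin Lt → Fin K → F

/-- The content of database `n`: the `M × Lt` array with entries `gₙᵀ w_{m,t}`. -/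
def stored {F : Type u} [Field F] {M N K Lt : ℕ} (G : Matrix (Fin K) (Fin N) F) (n : Fin N)
    (W : Messages F M Lt K) : Matrix (Fin M) (Fin Lt) F :=
  Matrix.of fun m t => ∑ k, G k n * W m t k

/-- The linear combination `c(1) W_1 + … + c(M) W_M` of the messages. -/
def linComb {F : Type u} [Field F] {M K Lt : ℕ} (c : Fin M → F) (W : Messages F M Lt K) :
    Fin Lt → Fin K → F :=
  fun t k => ∑ m, c m * W m t k

/-- `v` lists the coefficient vectors of all `V = (q^M - 1)/(q - 1)` linear combinations: nonzero
vectors, no two of which are proportional.  (The division is exact, so by counting every nonzero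
vector is a multiple of exactly one `v ν`.) -/
def IsCoeffSystem {F : Type u} [Field F] [Fintype F] {M V : ℕ} (v : Fin V → Fin M → F) : Prop :=
  V = (Fintype.card F ^ M - 1) / (Fintype.card F - 1) ∧
  (∀ ν, v ν ≠ 0) ∧
  ∀ ν ν' : Fin V, ∀ c : F, v ν' = c • v ν → ν' = ν

/-! ### Private function retrieval schemes -/

/-- A private function retrieval scheme for `N` databases and `V` linear combinations of `M`
messages.  The user draws private randomness from `law`, independently of the messages, computes
from it and the desired index the queries, and decodes from all answers and queries.  The answer of
a database is a deterministic function of its query and of its stored symbols; a database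
does not see the index. -/
structure PFRScheme (F : Type u) (M N K Lt V : ℕ) where
  /-- the user's private randomness -/
  Rand : Type u
  [fintypeRand : Fintype Rand]
  /-- the law of the private randomness -/
  law : Rand → ℝ
  law_mem : law ∈ stdSimplex ℝ Rand
  /-- alphabet of the queries -/
  Query : Type u
  /-- alphabet of the answer strings -/
  Answer : Type u
  /-- the query to each database, for a desired index -/
  query : Fin V → Rand → Fin N → Query
  /-- the answer of each database -/
  answer : Fin N → Query → Matrix (Fin M) (Fin Lt) F → Answer
  /-- the user's estimate of the desired linear combination -/
  decode : Fin V → (Fin N → Answer) → (Fin N → Query) → Fin Lt → Fin K → F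

attribute [instance] PFRScheme.fintypeRand

namespace PFRScheme

variable {F : Type u} [Field F] [Fintype F] {M N K Lt V : ℕ}

/-- The sample space: private randomness together with the messages. -/
abbrev Sample (S : PFRScheme F M N K Lt V) : Type u := S.Rand × Messages F M Lt K

/-- The joint law: the messages are uniform, and independent of the private randomness. -/
def weight (S : PFRScheme F M N K Lt V) (ω : S.Sample) : ℝ :=
  S.law ω.1 * (Fintype.card (Messages F M Lt K) : ℝ)⁻¹

/-- The random variable `Q_n^[ν]`. -/
def Q (S : PFRScheme F M N K Lt V) (ν : Fin V) (n : Fin N) (ω : S.Sample) : S.Query :=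
  S.query ν ω.1 n

/-- The random variable `A_n^[ν]`. -/
def A (S : PFRScheme F M N K Lt V) (G : Matrix (Fin K) (Fin N) F) (ν : Fin V) (n : Fin N)
    (ω : S.Sample) : S.Answer :=
  S.answer n (S.Q ν n ω) (stored G n ω.2)

/-- The queries are independent of the messages: `I(Q_1^[ν], …, Q_N^[ν]; W_1, …, W_M) = 0`. -/
def QueriesIndependent (S : PFRScheme F M N K Lt V) : Prop :=
  ∀ ν, mutualInfo S.weight (fun ω n => S.Q ν n ω) (fun ω => ω.2) = 0

/-- The answers are determined by query and content: `H(A_n^[ν] | Q_n^[ν], W_DBn) = 0`. -/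
def AnswersDetermined (S : PFRScheme F M N K Lt V) (G : Matrix (Fin K) (Fin N) F) : Prop :=
  ∀ ν n, condEntropy S.weight (S.A G ν n) (fun ω => (S.Q ν n ω, stored G n ω.2)) = 0

/-- Privacy: `I(A_n^[ν], Q_n^[ν], W_DBn; ν) = 0` for each database `n`, where `ν` is random with an
arbitrary distribution `μ` and is independent of the messages and of the private randomness. -/
def IsPrivate (S : PFRScheme F M N K Lt V) (G : Matrix (Fin K) (Fin N) F) : Prop :=
  ∀ n, ∀ μ ∈ stdSimplex ℝ (Fin V),
    mutualInfo (fun x : Fin V × S.Sample => μ x.1 * S.weight x.2)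
      (fun x => (S.A G x.1 n x.2, S.Q x.1 n x.2, stored G n x.2.2)) (fun x => x.1) = 0

/-- The residual uncertainty `H(W̃_ν | A_{1:N}^[ν], Q_{1:N}^[ν])`. -/
def equivocation (S : PFRScheme F M N K Lt V) (G : Matrix (Fin K) (Fin N) F)
    (v : Fin V → Fin M → F) (ν : Fin V) : ℝ :=
  condEntropy S.weight (fun ω => linComb (v ν) ω.2)
    (fun ω => ((fun n => S.A G ν n ω), (fun n => S.Q ν n ω)))

/-- The probability that the user decodes the desired linear combination incorrectly. -/
def errorProb (S : PFRScheme F M N K Lt V) (G : Matrix (Fin K) (Fin N) F)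
    (v : Fin V → Fin M → F) (ν : Fin V) : ℝ :=
  prob S.weight (fun ω =>
    S.decode ν (fun n => S.A G ν n ω) (fun n => S.Q ν n ω) ≠ linComb (v ν) ω.2) True

/-- The retrieval rate `H(W̃_ν) / ∑ₙ H(A_n^[ν])`. -/
def rate (S : PFRScheme F M N K Lt V) (G : Matrix (Fin K) (Fin N) F)
    (v : Fin V → Fin M → F) (ν : Fin V) : ℝ :=
  entropy S.weight (fun ω => linComb (v ν) ω.2) / ∑ n, entropy S.weight (S.A G ν n)

end PFRScheme

/-- `R` is an achievable rate: there is a sequence of private schemes of rate at least `R`, with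
message length `L = Lt j * K` tending to infinity, error probability tending to `0`, and
`H(W̃_ν | A_{1:N}^[ν], Q_{1:N}^[ν]) = o(L)`. -/
def IsAchievableRate {F : Type u} [Field F] [Fintype F] {M N K V : ℕ}
    (G : Matrix (Fin K) (Fin N) F) (v : Fin V → Fin M → F) (R : ℝ) : Prop :=
  ∃ (Lt : ℕ → ℕ) (S : ∀ j, PFRScheme F M N K (Lt j) V),
    Tendsto (fun j => Lt j * K) atTop atTop ∧
    (∀ j, (S j).QueriesIndependent ∧ (S j).AnswersDetermined G ∧ (S j).IsPrivate G) ∧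
    (∀ ν, Tendsto (fun j => (S j).errorProb G v ν) atTop (𝓝 0)) ∧
    (∀ ν, (fun j => (S j).equivocation G v ν) =o[atTop] fun j => ((Lt j * K : ℕ) : ℝ)) ∧
    ∀ j ν, R ≤ (S j).rate G v ν

end

/-! With `M = m + 1`, all linear combinations of the messages are treated at once as a linear
function of the coefficient vector in `V = F^(m+1)`. The user draws a uniform linear isomorphism `r`
from the segment space to a space of symbols: for each level `k ≤ m` and each block, a `k`-form on a
complement `C` of the line through the desired vector `v`. A query is a linear map from segments to
`k`-forms on `V`. A database substitutes its content, obtains a linear map from `V` to `k`-forms,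
and returns its alternatization, a `(k+1)`-form.

Decoding: on arguments from `C`, an answer shows only the interference of the queried block. Each
block is queried at `K` cyclically consecutive databases, so by the MDS property this interference
is known in every coordinate, hence also at the other databases. There it serves as side information
for level `k + 1`: on `(v, c)` an answer is the desired symbol plus interference of a parent block.
Again `K` databases suffice (`linComb_eq_zero`), so decoding has no error.

Privacy: `Λ^(k+1) V* = Λ^(k+1) C* ⊕ Λ^k C*`. The first summand carries the fresh symbol, the second
the parent symbol, and no symbol serves one database in both roles or twice. Hence `mix` is
surjective for every `v`; surjections with the same source and target differ by an automorphism,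
which the uniform `r` absorbs.

Rate: with `J K^(m-k) (N-K)^k` blocks per cyclic position at level `k`, fresh and side slots match
exactly. The symbol space has dimension `J N^(m+1)` and an answer `J K ∑ N^(m-i) K^i`, which gives
the claimed ratio. -/

noncomputable section

/-! ### Entropy on finite sample spaces -/

section Entropy

open Classical in
lemma prob_eq_sum_ite {Ω α : Type*} [Fintype Ω] (p : Ω → ℝ) (X : Ω → α) (x : α) :
    prob p X x = ∑ ω, if X ω = x then p ω else 0 := by
  rw [prob, Finset.sum_filter]

lemma prob_nonneg {Ω α : Type*} [Fintype Ω] {p : Ω → ℝ} (hp : ∀ ω, 0 ≤ p ω) (X : Ω → α) (x : α) :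
    0 ≤ prob p X x :=
  Finset.sum_nonneg fun ω _ => hp ω

lemma prob_le_one {Ω α : Type*} [Fintype Ω] {p : Ω → ℝ} (hp : p ∈ stdSimplex ℝ Ω) (X : Ω → α)
    (x : α) : prob p X x ≤ 1 := by
  classical
  rw [← hp.2]
  exact Finset.sum_le_sum_of_subset_of_nonneg (Finset.filter_subset _ _) fun ω _ _ => hp.1 ω

open Classical in
lemma sum_prob_image {Ω α : Type*} [Fintype Ω] (p : Ω → ℝ) (X : Ω → α) :
    ∑ x ∈ Finset.univ.image X, prob p X x = ∑ ω, p ω := by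
  rw [← Finset.sum_fiberwise_of_maps_to (s := Finset.univ) (t := Finset.univ.image X) (g := X)
    (fun ω _ => Finset.mem_image_of_mem X (Finset.mem_univ ω))]
  rfl

open Classical in
lemma prob_eq_zero_of_notMem {Ω α : Type*} [Fintype Ω] (p : Ω → ℝ) (X : Ω → α) {x : α}
    (hx : x ∉ Finset.univ.image X) : prob p X x = 0 := by
  rw [prob_eq_sum_ite]
  refine Finset.sum_eq_zero fun ω _ => if_neg ?_
  rintro rfl
  exact hx (Finset.mem_image_of_mem X (Finset.mem_univ ω))

lemma entropy_eq_sum_of_mem {Ω α : Type*} [Fintype Ω] (p : Ω → ℝ) (X : Ω → α) {s : Finset α}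
    (hs : ∀ ω, X ω ∈ s) : entropy p X = ∑ x ∈ s, Real.negMulLog (prob p X x) := by
  classical
  rw [entropy]
  refine Finset.sum_subset (Finset.image_subset_iff.2 fun ω _ => hs ω) fun x _ hx => ?_
  rw [prob_eq_zero_of_notMem p X hx, Real.negMulLog_zero]

lemma entropy_nonneg {Ω α : Type*} [Fintype Ω] {p : Ω → ℝ} (hp : p ∈ stdSimplex ℝ Ω)
    (X : Ω → α) : 0 ≤ entropy p X :=
  Finset.sum_nonneg fun x _ => Real.negMulLog_nonneg (prob_nonneg hp.1 X x) (prob_le_one hp X x)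

lemma prob_comp_of_injOn {Ω α β : Type*} [Fintype Ω] (p : Ω → ℝ) (Y : Ω → α) (g : α → β)
    (hg : Set.InjOn g (Set.range Y)) (ω : Ω) :
    prob p (fun ω => g (Y ω)) (g (Y ω)) = prob p Y (Y ω) := by
  classical
  simp only [prob_eq_sum_ite]
  refine Finset.sum_congr rfl fun ω' _ => ?_
  rw [hg.eq_iff (Set.mem_range_self ω') (Set.mem_range_self ω)]

lemma entropy_comp_of_injOn {Ω α β : Type*} [Fintype Ω] (p : Ω → ℝ) (Y : Ω → α) (g : α → β)
    (hg : Set.InjOn g (Set.range Y)) : entropy p (fun ω => g (Y ω)) = entropy p Y := by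
  classical
  rw [entropy, entropy]
  symm
  refine Finset.sum_bij (fun y _ => g y) ?_ ?_ ?_ ?_
  · simp only [Finset.mem_image, Finset.mem_univ, true_and]
    rintro _ ⟨ω, rfl⟩
    exact ⟨ω, rfl⟩
  · intro a ha b hb h
    refine hg ?_ ?_ h
    · simpa using ha
    · simpa using hb
  · simp
  · simp only [Finset.mem_image, Finset.mem_univ, true_and]
    rintro _ ⟨ω, rfl⟩
    rw [prob_comp_of_injOn p Y g hg]

/-- A function of `Y` has no conditional entropy given `Y`. -/
lemma condEntropy_eq_zero_of_eq_comp {Ω α β : Type*} [Fintype Ω] (p : Ω → ℝ) (X : Ω → α)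
    (Y : Ω → β) (f : β → α) (h : ∀ ω, X ω = f (Y ω)) : condEntropy p X Y = 0 := by
  have : (fun ω => (X ω, Y ω)) = fun ω => (fun y => (f y, y)) (Y ω) := by
    funext ω
    simp [h]
  rw [condEntropy, this, entropy_comp_of_injOn p Y (fun y => (f y, y)), sub_self]
  intro a _ b _ hab
  exact (Prod.ext_iff.1 hab).2

/-- Independent random variables have no mutual information. -/
lemma mutualInfo_eq_zero_of_prob_eq_mul {Ω α β : Type*} [Fintype Ω] {p : Ω → ℝ}
    (hp : ∑ ω, p ω = 1) (X : Ω → α) (Y : Ω → β)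
    (h : ∀ x y, prob p (fun ω => (X ω, Y ω)) (x, y) = prob p X x * prob p Y y) :
    mutualInfo p X Y = 0 := by
  classical
  have hsub : ∀ ω, (X ω, Y ω) ∈ Finset.univ.image X ×ˢ Finset.univ.image Y := by
    intro ω
    simp
  have hX := sum_prob_image p X
  have hY := sum_prob_image p Y
  rw [hp] at hX hY
  rw [mutualInfo, entropy_eq_sum_of_mem p (fun ω => (X ω, Y ω)) hsub, Finset.sum_product]
  simp only [h, Real.negMulLog_mul, Finset.sum_add_distrib]
  have h1 : ∑ x ∈ Finset.univ.image X, ∑ y ∈ Finset.univ.image Y,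
      prob p Y y * Real.negMulLog (prob p X x) = entropy p X := by
    simp only [← Finset.sum_mul, hY, one_mul]
    rfl
  have h2 : ∑ x ∈ Finset.univ.image X, ∑ y ∈ Finset.univ.image Y,
      prob p X x * Real.negMulLog (prob p Y y) = entropy p Y := by
    simp only [← Finset.mul_sum, ← Finset.sum_mul, hX, one_mul]
    rfl
  rw [h1, h2, sub_self]

/-- Gibbs' inequality against the uniform law, termwise from `log t ≤ t - 1`. It bounds the download
by the dimension of the answer space. -/
lemma entropy_le_log_card {Ω α : Type*} [Fintype Ω] [Fintype α] {p : Ω → ℝ}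
    (hp : p ∈ stdSimplex ℝ Ω) (X : Ω → α) : entropy p X ≤ Real.log (Fintype.card α) := by
  classical
  have hΩ : Nonempty Ω := by
    by_contra hne
    rw [not_nonempty_iff] at hne
    simpa using hp.2
  have hα : Nonempty α := hΩ.map X
  have hn : (0 : ℝ) < Fintype.card α := by exact_mod_cast Fintype.card_pos
  rw [entropy_eq_sum_of_mem p X (fun ω => Finset.mem_univ (X ω))]
  have hsum : ∑ x, prob p X x = 1 := by
    rw [← hp.2, ← sum_prob_image p X]
    symm
    exact Finset.sum_subset (Finset.subset_univ _) fun x _ hx => prob_eq_zero_of_notMem p X hx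
  have key : ∀ x, Real.negMulLog (prob p X x) ≤
      prob p X x * Real.log (Fintype.card α) + ((Fintype.card α : ℝ)⁻¹ - prob p X x) := by
    intro x
    rcases (prob_nonneg hp.1 X x).eq_or_lt with h0 | h0
    · rw [← h0, Real.negMulLog_zero]
      simp
    · have := Real.log_le_sub_one_of_pos (x := (Fintype.card α * prob p X x)⁻¹) (by positivity)
      rw [Real.log_inv, Real.log_mul hn.ne' h0.ne'] at this
      have h2 := mul_le_mul_of_nonneg_left this h0.le
      have h3 : prob p X x * ((Fintype.card α * prob p X x)⁻¹ - 1) =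
          (Fintype.card α : ℝ)⁻¹ - prob p X x := by
        field_simp
      rw [h3] at h2
      rw [Real.negMulLog]
      linarith
  refine (Finset.sum_le_sum fun x _ => key x).trans (le_of_eq ?_)
  rw [Finset.sum_add_distrib, Finset.sum_sub_distrib, ← Finset.sum_mul, hsum]
  simp [hn.ne']

lemma entropy_eq_log_card {Ω α : Type*} [Fintype Ω] [Fintype α] (p : Ω → ℝ) (X : Ω → α)
    (h : ∀ x, prob p X x = (Fintype.card α : ℝ)⁻¹) : entropy p X = Real.log (Fintype.card α) := by
  classical
  rw [entropy_eq_sum_of_mem p X (fun ω => Finset.mem_univ (X ω))]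
  simp only [h, Finset.sum_const, Finset.card_univ, nsmul_eq_mul, Real.negMulLog, Real.log_inv]
  by_cases hn : (Fintype.card α : ℝ) = 0
  · simp [hn]
  · field_simp

lemma prob_congr_equiv {Ω Ω' α : Type*} [Fintype Ω] [Fintype Ω'] (e : Ω ≃ Ω') (p : Ω → ℝ)
    (p' : Ω' → ℝ) (X : Ω → α) (X' : Ω' → α) (hp : ∀ ω, p' (e ω) = p ω) (hX : ∀ ω, X' (e ω) = X ω)
    (x : α) : prob p X x = prob p' X' x := by
  classical
  rw [prob_eq_sum_ite, prob_eq_sum_ite, ← e.sum_comp]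
  simp [hp, hX]

lemma prob_prod {Ω Ω' α β : Type*} [Fintype Ω] [Fintype Ω'] (p : Ω → ℝ) (p' : Ω' → ℝ) (X : Ω → α)
    (Y : Ω' → β) (x : α) (y : β) :
    prob (fun ω : Ω × Ω' => p ω.1 * p' ω.2) (fun ω => (X ω.1, Y ω.2)) (x, y) =
      prob p X x * prob p' Y y := by
  classical
  simp only [prob_eq_sum_ite, Finset.sum_mul_sum, Fintype.sum_prod_type, Prod.mk.injEq]
  refine Finset.sum_congr rfl fun ω _ => Finset.sum_congr rfl fun ω' _ => ?_
  split_ifs <;> simp_all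

lemma prob_fst {Ω Ω' α : Type*} [Fintype Ω] [Fintype Ω'] (p : Ω → ℝ) (p' : Ω' → ℝ)
    (hp' : ∑ ω, p' ω = 1) (X : Ω → α) (x : α) :
    prob (fun ω : Ω × Ω' => p ω.1 * p' ω.2) (fun ω => X ω.1) x = prob p X x := by
  classical
  simp only [prob_eq_sum_ite, Fintype.sum_prod_type]
  refine Finset.sum_congr rfl fun ω _ => ?_
  split_ifs
  · rw [← Finset.mul_sum, hp', mul_one]
  · simp

lemma prob_snd {Ω Ω' α : Type*} [Fintype Ω] [Fintype Ω'] (p : Ω → ℝ) (p' : Ω' → ℝ)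
    (hp : ∑ ω, p ω = 1) (Y : Ω' → α) (y : α) :
    prob (fun ω : Ω × Ω' => p ω.1 * p' ω.2) (fun ω => Y ω.2) y = prob p' Y y := by
  classical
  simp only [prob_eq_sum_ite, Fintype.sum_prod_type]
  rw [Finset.sum_comm]
  refine Finset.sum_congr rfl fun ω _ => ?_
  split_ifs
  · rw [← Finset.sum_mul, hp, one_mul]
  · simp

lemma mutualInfo_prod_eq_zero {Ω Ω' α β : Type*} [Fintype Ω] [Fintype Ω'] {p : Ω → ℝ}
    {p' : Ω' → ℝ} (hp : ∑ ω, p ω = 1) (hp' : ∑ ω, p' ω = 1) (X : Ω → α) (Y : Ω' → β) :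
    mutualInfo (fun ω : Ω × Ω' => p ω.1 * p' ω.2) (fun ω => X ω.1) (fun ω => Y ω.2) = 0 := by
  refine mutualInfo_eq_zero_of_prob_eq_mul ?_ _ _ fun x y => ?_
  · rw [Fintype.sum_prod_type]
    simp [← Finset.mul_sum, hp, hp']
  · rw [prob_prod, prob_fst p p' hp', prob_snd p p' hp]

/-- If the law of `X i` does not depend on `i`, then `X` is independent of a random index. -/
lemma mutualInfo_index_eq_zero {I Ω α : Type*} [Fintype I] [Fintype Ω] {μ : I → ℝ} {p : Ω → ℝ}
    (hμ : ∑ i, μ i = 1) (hp : ∑ ω, p ω = 1) (X : I → Ω → α)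
    (h : ∀ i j x, prob p (X i) x = prob p (X j) x) :
    mutualInfo (fun z : I × Ω => μ z.1 * p z.2) (fun z => X z.1 z.2) (fun z => z.1) = 0 := by
  classical
  have hj : ∀ x i, prob (fun z : I × Ω => μ z.1 * p z.2) (fun z => (X z.1 z.2, z.1)) (x, i) =
      μ i * prob p (X i) x := by
    intro x i
    simp only [prob_eq_sum_ite, Fintype.sum_prod_type, Prod.mk.injEq, Finset.mul_sum]
    rw [Finset.sum_eq_single i]
    · simp [mul_ite]
    · intro j _ hji
      simp [hji]
    · simp
  have hX : ∀ x i, prob (fun z : I × Ω => μ z.1 * p z.2) (fun z => X z.1 z.2) x =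
      prob p (X i) x := by
    intro x i
    have : prob (fun z : I × Ω => μ z.1 * p z.2) (fun z => X z.1 z.2) x =
        ∑ j, μ j * prob p (X j) x := by
      simp only [prob_eq_sum_ite, Fintype.sum_prod_type, Finset.mul_sum, mul_ite, mul_zero]
    rw [this]
    simp only [h _ i, ← Finset.sum_mul, hμ, one_mul]
  refine mutualInfo_eq_zero_of_prob_eq_mul ?_ _ _ fun x i => ?_
  · rw [Fintype.sum_prod_type]
    simp [← Finset.mul_sum, hp, hμ]
  · have hi : prob μ (fun i => i) i = μ i := by
      simp [prob_eq_sum_ite]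
    rw [hj, hX x i, prob_fst μ p hp (fun i => i), hi, mul_comm]

/-- If all outcomes have positive probability, a random variable of entropy `0` is constant. -/
lemma eq_of_entropy_eq_zero {Ω α : Type*} [Fintype Ω] {p : Ω → ℝ} (hp : p ∈ stdSimplex ℝ Ω)
    (hpos : ∀ ω, 0 < p ω) (X : Ω → α) (h : entropy p X = 0) (ω₁ ω₂ : Ω) : X ω₁ = X ω₂ := by
  classical
  by_contra hne
  have h0 := (Finset.sum_eq_zero_iff_of_nonneg fun x _ =>
    Real.negMulLog_nonneg (prob_nonneg hp.1 X x) (prob_le_one hp X x)).1 h (X ω₁)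
    (Finset.mem_image_of_mem X (Finset.mem_univ ω₁))
  have hpr : 0 < prob p X (X ω₁) :=
    (hpos ω₁).trans_le (Finset.single_le_sum (f := p) (fun ω _ => hp.1 ω) (by simp))
  have hlt : prob p X (X ω₁) < 1 := by
    rw [← hp.2]
    refine Finset.sum_lt_sum_of_subset (Finset.filter_subset _ _) (Finset.mem_univ ω₂) ?_
      (hpos ω₂) fun ω _ _ => hp.1 ω
    simp [Ne.symm hne]
  have := Real.log_neg hpr hlt
  rw [Real.negMulLog] at h0
  nlinarith

/-- A surjective additive map pushes the uniform law to the uniform law. -/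
lemma prob_addMonoidHom {Ω α : Type*} [Fintype Ω] [AddGroup Ω] [AddGroup α] [Fintype α]
    (f : Ω →+ α) (hf : Function.Surjective f) (x : α) :
    prob (fun _ : Ω => (Fintype.card Ω : ℝ)⁻¹) f x = (Fintype.card α : ℝ)⁻¹ := by
  classical
  have hconst : ∀ y, prob (fun _ : Ω => (Fintype.card Ω : ℝ)⁻¹) f y =
      prob (fun _ : Ω => (Fintype.card Ω : ℝ)⁻¹) f x := by
    intro y
    -- Right translation by a lift of `-y + x` carries the fibre over `y` onto the fibre over `x`.
    obtain ⟨a, ha⟩ := hf (-y + x)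
    simp only [prob_eq_sum_ite]
    symm
    rw [← Equiv.sum_comp (Equiv.addRight a)]
    refine Finset.sum_congr rfl fun ω _ => ?_
    have : f ω = y ↔ f (Equiv.addRight a ω) = x := by
      rw [Equiv.coe_addRight, map_add, ha, ← add_assoc]
      constructor
      · intro h
        simp [h]
      · intro h
        have h' : f ω + -y = 0 := by simpa using h
        exact add_neg_eq_zero.1 h'
    simp only [this]
  have hsum : ∑ y, prob (fun _ : Ω => (Fintype.card Ω : ℝ)⁻¹) f y = 1 := by
    have h1 := sum_prob_image (fun _ : Ω => (Fintype.card Ω : ℝ)⁻¹) f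
    rw [Finset.image_univ_of_surjective hf] at h1
    rw [h1]
    have : (Fintype.card Ω : ℝ) ≠ 0 := by exact_mod_cast Fintype.card_ne_zero
    simp [this]
  simp only [hconst, Finset.sum_const, Finset.card_univ, nsmul_eq_mul] at hsum
  exact eq_inv_of_mul_eq_one_right hsum

end Entropy

/-! ### Alternating forms and splittings -/

section AlternatingForms

variable {F : Type u} [Field F] {V C : Type*} [AddCommGroup V] [Module F V] [AddCommGroup C]
  [Module F C]

instance finite_alternatingForms [FiniteDimensional F V] (k : ℕ) :
    FiniteDimensional F (V [⋀^Fin k]→ₗ[F] F) :=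
  Module.Finite.equiv (exteriorPower.alternatingMapLinearEquiv (R := F) (M := V) (N := F)
    (n := k)).symm

lemma finrank_alternatingForms [FiniteDimensional F V] (k : ℕ) :
    Module.finrank F (V [⋀^Fin k]→ₗ[F] F) = (Module.finrank F V).choose k := by
  rw [(exteriorPower.alternatingMapLinearEquiv (R := F) (M := V) (N := F) (n := k)).finrank_eq,
    Module.finrank_linearMap, exteriorPower.finrank_eq, Module.finrank_self, mul_one]

/-- A decomposition of `V` as the line through `v` plus a complement identified with `C`. -/
structure LineSplitting (F : Type u) [Field F] {V : Type*} (C : Type*) [AddCommGroup V] [Module F V]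
    [AddCommGroup C] [Module F C] (v : V) where
  /-- the coordinate along `v` -/
  coord : V →ₗ[F] F
  /-- the projection onto the complement -/
  proj : V →ₗ[F] C
  /-- the inclusion of the complement -/
  incl : C →ₗ[F] V
  coord_self : coord v = 1
  proj_self : proj v = 0
  coord_incl : ∀ c, coord (incl c) = 0
  proj_incl : ∀ c, proj (incl c) = c

lemma exists_lineSplitting [FiniteDimensional F V] [FiniteDimensional F C]
    (h : Module.finrank F V = Module.finrank F C + 1) {v : V} (hv : v ≠ 0) :
    Nonempty (LineSplitting F C v) := by
  obtain ⟨f, hf⟩ : ∃ f : Module.Dual F V, f v ≠ 0 := by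
    by_contra! h0
    exact hv ((Module.forall_dual_apply_eq_zero_iff F v).1 h0)
  have hf0 : f ≠ 0 := by
    rintro rfl
    exact hf rfl
  have hker : Module.finrank F (LinearMap.ker f) = Module.finrank F C := by
    have := Module.Dual.finrank_ker_add_one_of_ne_zero (f := f) hf0
    omega
  let e : LinearMap.ker f ≃ₗ[F] C := LinearEquiv.ofFinrankEq _ _ hker
  let g : V →ₗ[F] F := (f v)⁻¹ • f
  have hg : g v = 1 := by simp [g, hf]
  have hgk : ∀ c : LinearMap.ker f, g c = 0 := fun c => by
    simp [g, LinearMap.mem_ker.1 c.2]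
  -- The projection is `u ↦ u - g(u) v`; it kills `v` and fixes `ker f`, which is identified with
  -- `C`.
  have hmem : ∀ u, (LinearMap.id - g.smulRight v : V →ₗ[F] V) u ∈ LinearMap.ker f := by
    intro u
    simp only [LinearMap.mem_ker, LinearMap.sub_apply, LinearMap.id_apply, map_sub,
      LinearMap.smulRight_apply, map_smul, g, LinearMap.smul_apply, smul_eq_mul]
    field_simp
    ring
  exact ⟨{
    coord := g
    proj := e.toLinearMap ∘ₗ LinearMap.codRestrict _ (LinearMap.id - g.smulRight v : V →ₗ[F] V) hmem
    incl := (LinearMap.ker f).subtype ∘ₗ e.symm.toLinearMap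
    coord_self := hg
    proj_self := by
      have : LinearMap.codRestrict _ (LinearMap.id - g.smulRight v : V →ₗ[F] V) hmem v = 0 := by
        ext
        simp [hg]
      simp [this]
    coord_incl := fun c => hgk _
    proj_incl := fun c => by
      have : LinearMap.codRestrict _ (LinearMap.id - g.smulRight v : V →ₗ[F] V) hmem (e.symm c) = e.symm c := by
        ext
        simp [hgk]
      simp [this] }⟩

namespace LineSplitting

variable {v : V} (s : LineSplitting F C v)

/-- Pull back a form along the projection. -/
def pullback (k : ℕ) : (C [⋀^Fin k]→ₗ[F] F) →ₗ[F] (V [⋀^Fin k]→ₗ[F] F) where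
  toFun a := a.compLinearMap s.proj
  map_add' _ _ := rfl
  map_smul' _ _ := rfl

/-- Pull back a form along the projection and multiply it by the coordinate along `v`. -/
def wedge (k : ℕ) : (C [⋀^Fin k]→ₗ[F] F) →ₗ[F] (V [⋀^Fin (k + 1)]→ₗ[F] F) :=
  AlternatingMap.alternatizeUncurryFinLM ∘ₗ LinearMap.smulRightₗ s.coord ∘ₗ s.pullback k

@[simp]
lemma pullback_apply {k : ℕ} (a : C [⋀^Fin k]→ₗ[F] F) (u : Fin k → V) :
    s.pullback k a u = a fun i => s.proj (u i) := rfl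

lemma wedge_apply {k : ℕ} (b : C [⋀^Fin k]→ₗ[F] F) (u : Fin (k + 1) → V) :
    s.wedge k b u =
      ∑ i : Fin (k + 1), (-1) ^ (i : ℕ) • (s.coord (u i) • b fun j => s.proj (i.removeNth u j)) := by
  simp [wedge, AlternatingMap.alternatizeUncurryFin_apply]

lemma pullback_incl {k : ℕ} (a : C [⋀^Fin k]→ₗ[F] F) (c : Fin k → C) :
    s.pullback k a (fun i => s.incl (c i)) = a c := by
  simp [s.proj_incl]

lemma wedge_incl {k : ℕ} (b : C [⋀^Fin k]→ₗ[F] F) (c : Fin (k + 1) → C) :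
    s.wedge k b (fun i => s.incl (c i)) = 0 := by
  simp [wedge_apply, s.coord_incl]

lemma pullback_cons {k : ℕ} (a : C [⋀^Fin (k + 1)]→ₗ[F] F) (u : Fin k → V) :
    s.pullback (k + 1) a (Fin.cons v u : Fin (k + 1) → V) = 0 := by
  rw [pullback_apply]
  exact a.map_coord_zero 0 (by simp [s.proj_self])

/-- The coordinate vanishes on the complement, so only the term that feeds `v` to it survives. -/
lemma wedge_cons {k : ℕ} (b : C [⋀^Fin k]→ₗ[F] F) (c : Fin k → C) :
    s.wedge k b (Fin.cons v fun i => s.incl (c i) : Fin (k + 1) → V) = b c := by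
  rw [wedge_apply, Fin.sum_univ_succ]
  simp [s.coord_self, s.coord_incl, s.proj_incl, Fin.removeNth_apply]

/-- Every form of positive degree on `V` is determined by its restriction to the complement and
by the restriction of its contraction with `v`. -/
lemma pullback_restrict_add_wedge_contract [FiniteDimensional F V] [FiniteDimensional F C]
    (h : Module.finrank F V = Module.finrank F C + 1) {k : ℕ} (β : V [⋀^Fin (k + 1)]→ₗ[F] F) :
    s.pullback (k + 1) (β.compLinearMap s.incl) +
      s.wedge k ((β.curryLeft v).compLinearMap s.incl) = β := by
  let T : (C [⋀^Fin (k + 1)]→ₗ[F] F) × (C [⋀^Fin k]→ₗ[F] F) →ₗ[F] (V [⋀^Fin (k + 1)]→ₗ[F] F) :=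
    (s.pullback (k + 1)).coprod (s.wedge k)
  have hrestrict : ∀ a b, (T (a, b)).compLinearMap s.incl = a ∧
      ((T (a, b)).curryLeft v).compLinearMap s.incl = b := by
    refine fun a b => ⟨AlternatingMap.ext fun c => ?_, AlternatingMap.ext fun c => ?_⟩
    · change s.pullback (k + 1) a (fun i => s.incl (c i)) +
        s.wedge k b (fun i => s.incl (c i)) = a c
      rw [pullback_incl, wedge_incl, add_zero]
    · change s.pullback (k + 1) a (Fin.cons v fun i => s.incl (c i) : Fin (k + 1) → V) +
        s.wedge k b (Fin.cons v fun i => s.incl (c i) : Fin (k + 1) → V) = b c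
      rw [pullback_cons, wedge_cons, zero_add]
  have hinj : Function.Injective T := by
    rintro ⟨a, b⟩ ⟨a', b'⟩ hab
    refine Prod.ext ?_ ?_
    · rw [← (hrestrict a b).1, hab, (hrestrict a' b').1]
    · rw [← (hrestrict a b).2, hab, (hrestrict a' b').2]
  -- Restriction and contraction give a left inverse of `T`; Pascal's rule makes the dimensions
  -- equal, so `T` is onto as well.
  have hdim : Module.finrank F ((C [⋀^Fin (k + 1)]→ₗ[F] F) × (C [⋀^Fin k]→ₗ[F] F)) =
      Module.finrank F (V [⋀^Fin (k + 1)]→ₗ[F] F) := by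
    rw [Module.finrank_prod, finrank_alternatingForms, finrank_alternatingForms,
      finrank_alternatingForms, h, Nat.choose_succ_succ', add_comm]
  obtain ⟨⟨a, b⟩, rfl⟩ := (LinearMap.injective_iff_surjective_of_finrank_eq_finrank hdim).1 hinj β
  rw [(hrestrict a b).1, (hrestrict a b).2]
  rfl

lemma pullback_restrict_zero (β : V [⋀^Fin 0]→ₗ[F] F) :
    s.pullback 0 (β.compLinearMap s.incl) = β := by
  refine AlternatingMap.ext fun u => ?_
  rw [pullback_apply, AlternatingMap.compLinearMap_apply]
  congr 1
  exact Subsingleton.elim _ _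

end LineSplitting

end AlternatingForms

/-! ### Surjections with a common source and target -/

lemma exists_equiv_prod_ker {F : Type*} [Field F] {Y Z : Type*} [AddCommGroup Y] [Module F Y]
    [AddCommGroup Z] [Module F Z] (S : Y →ₗ[F] Z) (hS : Function.Surjective S) :
    ∃ e : Y ≃ₗ[F] Z × LinearMap.ker S, ∀ y, (e y).1 = S y := by
  obtain ⟨P, hP⟩ := Submodule.exists_isCompl (LinearMap.ker S)
  refine ⟨LinearMap.equivProdOfSurjectiveOfIsCompl S
    ((LinearMap.ker S).projectionOnto P hP) (LinearMap.range_eq_top.2 hS) (by simp)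
    (by simpa using hP), fun y => rfl⟩

/-- Two surjections from the same finite-dimensional space differ by an automorphism. -/
lemma exists_equiv_comp_eq {F : Type*} [Field F] {Y Z : Type*} [AddCommGroup Y] [Module F Y]
    [AddCommGroup Z] [Module F Z] [FiniteDimensional F Y] (S T : Y →ₗ[F] Z)
    (hS : Function.Surjective S) (hT : Function.Surjective T) :
    ∃ e : Y ≃ₗ[F] Y, S ∘ₗ e.toLinearMap = T := by
  obtain ⟨eS, heS⟩ := exists_equiv_prod_ker S hS
  obtain ⟨eT, heT⟩ := exists_equiv_prod_ker T hT
  have hker : Module.finrank F (LinearMap.ker T) = Module.finrank F (LinearMap.ker S) := by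
    have h1 := S.finrank_range_add_finrank_ker
    have h2 := T.finrank_range_add_finrank_ker
    rw [LinearMap.range_eq_top.2 hS] at h1
    rw [LinearMap.range_eq_top.2 hT] at h2
    omega
  -- Both kernels have the same dimension, so the identity on `Z` extends by any isomorphism between
  -- them.
  refine ⟨eT.trans (((LinearEquiv.refl F Z).prodCongr (LinearEquiv.ofFinrankEq _ _ hker)).trans
    eS.symm), LinearMap.ext fun y => ?_⟩
  rw [LinearMap.comp_apply, ← heS, ← heT]
  simp

/-! ### Symbols, slots and answers -/

section Layout

/-- Blocks at a level: block `(c, t)` is queried at the databases `c, c + 1, …, c + K - 1`. -/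
abbrev Block (N a : ℕ) : Type := Fin N × Fin a

/-- Slots of a database at a level: slot `(p, t)` of database `n` queries block `(n - p, t)`. -/
abbrev Slot (K N a : ℕ) : Type := {p : Fin N // p.val < K} × Fin a

/-- Blocks of a level as seen by a database outside of them. -/
abbrev SideSlot (K N a : ℕ) : Type := {p : Fin N // ¬ p.val < K} × Fin a

/-- The symbols of one message in the coordinates chosen by the user: a form of degree `k` for every
block at level `k`. -/
abbrev Symbols (F : Type u) [Field F] (m N : ℕ) (a : ℕ → ℕ) : Type u :=
  (k : Fin (m + 1)) → Block N (a k) → (Fin m → F) [⋀^Fin k]→ₗ[F] F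

/-- What a query extracts from one message. -/
abbrev Extract (F : Type u) [Field F] (m K N : ℕ) (a : ℕ → ℕ) : Type u :=
  (k : Fin (m + 1)) → Slot K N (a k) → (Fin (m + 1) → F) [⋀^Fin k]→ₗ[F] F

/-- An answer: a form of degree `k + 1` for every slot at level `k`. -/
abbrev Answers (F : Type u) [Field F] (m K N : ℕ) (a : ℕ → ℕ) : Type u :=
  (k : Fin (m + 1)) → Slot K N (a k) → (Fin (m + 1) → F) [⋀^Fin (k + 1)]→ₗ[F] F

/-- For every slot at a level `k + 1`, the block at level `k` that provides its side information. -/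
abbrev Parents (m K N : ℕ) (a : ℕ → ℕ) : Type :=
  ∀ k, k + 1 < m + 1 → (Slot K N (a (k + 1)) ↪ SideSlot K N (a k))

variable {F : Type u} [Field F] {m K N : ℕ} {a : ℕ → ℕ} {v : Fin (m + 1) → F}

/-- The query to database `n` in the coordinates chosen by the user. -/
def mix (par : Parents m K N a) (s : LineSplitting F (Fin m → F) v) (n : Fin N) :
    Symbols F m N a →ₗ[F] Extract F m K N a where
  toFun y
    | ⟨0, h⟩, i => s.pullback 0 (y ⟨0, h⟩ (n - i.1.1, i.2))
    -- The fresh symbol has degree `k + 1`; the parent symbol, of degree `k`, is raised by the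
    -- coordinate along `v`.
    | ⟨k + 1, h⟩, i => s.pullback (k + 1) (y ⟨k + 1, h⟩ (n - i.1.1, i.2)) +
        s.wedge k (y ⟨k, (Nat.lt_succ_self k).trans h⟩
          (n - (par k h i).1.1, (par k h i).2))
  map_add' y z := by
    funext ⟨k, h⟩ i
    cases k with
    | zero => exact map_add _ _ _
    | succ k =>
      change s.pullback (k + 1) (_ + _) + s.wedge k (_ + _) = (_ + _) + (_ + _)
      rw [map_add, map_add]
      abel
  map_smul' c y := by
    funext ⟨k, h⟩ i
    cases k with
    | zero => exact map_smul (s.pullback 0) c _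
    | succ k =>
      change s.pullback (k + 1) (c • _) + s.wedge k (c • _) = c • (_ + _)
      rw [map_smul, map_smul, smul_add]

lemma mix_incl (par : Parents m K N a) (s : LineSplitting F (Fin m → F) v) (n : Fin N)
    (y : Symbols F m N a) (k : Fin (m + 1)) (i : Slot K N (a k)) (c : Fin k → Fin m → F) :
    mix par s n y k i (fun j => s.incl (c j)) = y k (n - i.1.1, i.2) c := by
  obtain ⟨k, h⟩ := k
  cases k with
  | zero => exact s.pullback_incl _ c
  | succ k =>
    change s.pullback (k + 1) _ _ + s.wedge k _ _ = _
    rw [s.pullback_incl, s.wedge_incl, add_zero]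

lemma mix_cons (par : Parents m K N a) (s : LineSplitting F (Fin m → F) v) (n : Fin N)
    (y : Symbols F m N a) (k : ℕ) (h : k + 1 < m + 1) (i : Slot K N (a (k + 1)))
    (c : Fin k → Fin m → F) :
    mix par s n y ⟨k + 1, h⟩ i (Fin.cons v fun j => s.incl (c j) : Fin (k + 1) → _) =
      y ⟨k, (Nat.lt_succ_self k).trans h⟩ (n - (par k h i).1.1, (par k h i).2) c := by
  change s.pullback (k + 1) _ _ + s.wedge k _ _ = _
  rw [s.pullback_cons, s.wedge_cons, zero_add]

/-- A database outside a block meets it only as a parent, and at most once since `par` is injective.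
So all restrictions and contractions of the target can be prescribed independently. -/
lemma mix_surjective [NeZero N] (par : Parents m K N a) (s : LineSplitting F (Fin m → F) v) (n : Fin N) :
    Function.Surjective (mix par s n) := by
  classical
  intro β
  have hdim : Module.finrank F (Fin (m + 1) → F) = Module.finrank F (Fin m → F) + 1 := by simp
  -- A queried block receives a restriction, a parent block a contraction; blocks that database `n`
  -- never touches are set to `0`.
  let y : Symbols F m N a := fun k b =>
    if hp : (n - b.1).val < K then (β k (⟨n - b.1, hp⟩, b.2)).compLinearMap s.incl
    else if hk : k.val + 1 < m + 1 then
      if hi : ∃ i, par k hk i = (⟨n - b.1, hp⟩, b.2) then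
        ((β ⟨k + 1, hk⟩ hi.choose).curryLeft v).compLinearMap s.incl
      else 0
    else 0
  have hy : ∀ (k : Fin (m + 1)) (i : Slot K N (a k)), y k (n - i.1.1, i.2) = (β k i).compLinearMap s.incl := by
    intro k i
    have h1 : n - (n - i.1.1) = i.1.1 := sub_sub_cancel _ _
    have hp : (n - (n - i.1.1)).val < K := by
      rw [h1]
      exact i.1.2
    have h2 : ((⟨n - (n - i.1.1), hp⟩, i.2) : Slot K N (a k)) = i := Prod.ext (Subtype.ext h1) rfl
    simp only [y]
    rw [dif_pos hp, h2]
  have hy' : ∀ k (h : k + 1 < m + 1) (i : Slot K N (a (k + 1))),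
      y ⟨k, (Nat.lt_succ_self k).trans h⟩ (n - (par k h i).1.1, (par k h i).2) =
        ((β ⟨k + 1, h⟩ i).curryLeft v).compLinearMap s.incl := by
    intro k h i
    have h1 : n - (n - (par k h i).1.1) = (par k h i).1.1 := sub_sub_cancel _ _
    have hp : ¬ (n - (n - (par k h i).1.1)).val < K := by
      rw [h1]
      exact (par k h i).1.2
    have h2 : ((⟨n - (n - (par k h i).1.1), hp⟩, (par k h i).2) : SideSlot K N (a k)) =
      par k h i := Prod.ext (Subtype.ext h1) rfl
    have hex : ∃ j, par k h j = (⟨n - (n - (par k h i).1.1), hp⟩, (par k h i).2) := ⟨i, h2.symm⟩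
    have hch : hex.choose = i := (par k h).injective (hex.choose_spec.trans h2)
    simp only [y]
    rw [dif_neg hp, dif_pos h, dif_pos hex, hch]
  refine ⟨y, ?_⟩
  funext ⟨k, h⟩ i
  cases k with
  | zero =>
    change s.pullback 0 (y ⟨0, h⟩ (n - i.1.1, i.2)) = _
    rw [hy]
    exact s.pullback_restrict_zero _
  | succ k =>
    change s.pullback (k + 1) (y ⟨k + 1, h⟩ (n - i.1.1, i.2)) + s.wedge k _ = _
    rw [hy, hy']
    exact s.pullback_restrict_add_wedge_contract hdim _

/-- The answer to the query `P` of a database storing `X`. -/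
def respond {Lt : ℕ} (P : (Fin Lt → F) →ₗ[F] Extract F m K N a)
    (X : Matrix (Fin (m + 1)) (Fin Lt) F) : Answers F m K N a := fun k i =>
  AlternatingMap.alternatizeUncurryFin
    (LinearMap.proj i ∘ₗ LinearMap.proj k ∘ₗ P ∘ₗ Matrix.vecMulLinear X)

lemma respond_apply {Lt : ℕ} (P : (Fin Lt → F) →ₗ[F] Extract F m K N a)
    (X : Matrix (Fin (m + 1)) (Fin Lt) F) (k : Fin (m + 1)) (i : Slot K N (a k))
    (u : Fin (k + 1) → Fin (m + 1) → F) :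
    respond P X k i u =
      ∑ j : Fin (k + 1), (-1) ^ (j : ℕ) • P (Matrix.vecMul (u j) X) k i (j.removeNth u) := by
  rw [respond, AlternatingMap.alternatizeUncurryFin_apply]
  rfl

/-- Linearity in the content reduces decoding to the case of vanishing answers. -/
lemma respond_sub {Lt : ℕ} (P : (Fin Lt → F) →ₗ[F] Extract F m K N a)
    (X X' : Matrix (Fin (m + 1)) (Fin Lt) F) :
    respond P (X - X') = respond P X - respond P X' := by
  funext k i
  refine AlternatingMap.ext fun u => ?_
  rw [Pi.sub_apply, Pi.sub_apply, AlternatingMap.sub_apply, respond_apply, respond_apply,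
    respond_apply, ← Finset.sum_sub_distrib]
  refine Finset.sum_congr rfl fun j _ => ?_
  rw [Matrix.vecMul_sub, map_sub, Pi.sub_apply, Pi.sub_apply, AlternatingMap.sub_apply, smul_sub]

end Layout

/-! ### Decoding -/

section Decoding

/-- `K` cyclically consecutive columns of an MDS generator matrix determine a vector. -/
lemma IsMDS.eq_zero_of_consecutive {F : Type u} [Field F] {K N : ℕ} [NeZero N] (hKN : K ≤ N)
    {G : Matrix (Fin K) (Fin N) F} (hG : IsMDS G) (c : Fin N) (x : Fin K → F)
    (h : ∀ p : Fin N, p.val < K → ∑ κ, G κ (c + p) * x κ = 0) : x = 0 := by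
  classical
  let S : Finset (Fin N) := (Finset.univ.filter fun p : Fin N => p.val < K).map
    (Equiv.addLeft c).toEmbedding
  have hS : S.card = K := by
    rw [Finset.card_map, Fin.card_filter_val_lt, min_eq_right hKN]
  -- `K` independent columns span `F^K`, so pairing with `x` vanishes identically.
  have hspan := (hG S hS).span_eq_top_of_card_eq_finrank' (by simp [hS])
  let f : (Fin K → F) →ₗ[F] F := ∑ κ, x κ • LinearMap.proj κ
  have hf : ∀ z, f z = ∑ κ, z κ * x κ := fun z => by
    simp [f, mul_comm]
  have hf0 : f = 0 := by
    refine LinearMap.ext_on hspan ?_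
    rintro _ ⟨⟨n, hn⟩, rfl⟩
    obtain ⟨p, hp, rfl⟩ := Finset.mem_map.1 hn
    rw [hf]
    exact h p (by simpa using hp)
  funext κ
  have := hf (Pi.single κ 1)
  rw [hf0] at this
  simpa [Pi.single_apply] using this.symm

variable {F : Type u} [Field F] {m K N Lt : ℕ} {a : ℕ → ℕ} {v : Fin (m + 1) → F}

/-- The `κ`-th symbols of all segments of the linear combinations of the messages. -/
def column (r : (Fin Lt → F) ≃ₗ[F] Symbols F m N a) (W : Messages F (m + 1) Lt K) (κ : Fin K) :
    (Fin (m + 1) → F) →ₗ[F] Symbols F m N a :=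
  r.toLinearMap ∘ₗ Matrix.vecMulLinear (Matrix.of fun μ t => W μ t κ)

/-- The code mixes the `K` symbols within a segment, while `r` mixes segments; the two operations
commute. -/
lemma vecMul_stored (r : (Fin Lt → F) ≃ₗ[F] Symbols F m N a) (G : Matrix (Fin K) (Fin N) F)
    (W : Messages F (m + 1) Lt K) (n : Fin N) (u : Fin (m + 1) → F) :
    r (Matrix.vecMul u (stored G n W)) = ∑ κ, G κ n • column r W κ u := by
  have : Matrix.vecMul u (stored G n W) =
      ∑ κ, G κ n • Matrix.vecMul u (Matrix.of fun μ t => W μ t κ) := by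
    funext t
    simp only [Matrix.vecMul, dotProduct, stored, Matrix.of_apply, Finset.sum_apply, Pi.smul_apply,
      smul_eq_mul, Finset.mul_sum]
    rw [Finset.sum_comm]
    refine Finset.sum_congr rfl fun κ _ => Finset.sum_congr rfl fun μ _ => by ring
  rw [this, map_sum]
  simp only [map_smul]
  rfl

lemma sum_smul_symbols_apply {ι : Type*} [Fintype ι] (g : ι → F) (y : ι → Symbols F m N a)
    (k : Fin (m + 1)) (b : Block N (a k)) (c : Fin k → Fin m → F) :
    (∑ i, g i • y i) k b c = ∑ i, g i * y i k b c := by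
  let L : Symbols F m N a →ₗ[F] F :=
    { toFun := fun y => y k b c
      map_add' := fun _ _ => rfl
      map_smul' := fun _ _ => rfl }
  exact (map_sum L _ _).trans (Finset.sum_congr rfl fun i _ => map_smul L _ _)

/-- The interference seen by a database is a combination of the columns' interferences. -/
lemma interference_stored (s : LineSplitting F (Fin m → F) v)
    (r : (Fin Lt → F) ≃ₗ[F] Symbols F m N a) (G : Matrix (Fin K) (Fin N) F)
    (W : Messages F (m + 1) Lt K) (n : Fin N)
    (k : Fin (m + 1)) (b : Block N (a k)) (c : Fin (k + 1) → Fin m → F) :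
    ∑ j : Fin (k + 1), (-1) ^ (j : ℕ) •
        r (Matrix.vecMul (s.incl (c j)) (stored G n W)) k b (j.removeNth c) =
      ∑ κ, G κ n * ∑ j : Fin (k + 1), (-1) ^ (j : ℕ) •
        column r W κ (s.incl (c j)) k b (j.removeNth c) := by
  simp only [vecMul_stored, sum_smul_symbols_apply, Finset.mul_sum, Finset.smul_sum]
  rw [Finset.sum_comm]
  refine Finset.sum_congr rfl fun j _ => Finset.sum_congr rfl fun κ _ => ?_
  rw [mul_smul_comm]

variable [NeZero N]

/-- The interference of every block vanishes if all answers do. -/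
lemma interference_eq_zero (hKN : K ≤ N) {G : Matrix (Fin K) (Fin N) F} (hG : IsMDS G)
    (par : Parents m K N a) (s : LineSplitting F (Fin m → F) v)
    (r : (Fin Lt → F) ≃ₗ[F] Symbols F m N a) (W : Messages F (m + 1) Lt K)
    (h : ∀ n, respond (mix par s n ∘ₗ r.toLinearMap) (stored G n W) = 0)
    (k : Fin (m + 1)) (b : Block N (a k)) (c : Fin (k + 1) → Fin m → F) (κ : Fin K) :
    ∑ j : Fin (k + 1), (-1) ^ (j : ℕ) •
      column r W κ (s.incl (c j)) k b (j.removeNth c) = 0 := by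
  refine congrFun (hG.eq_zero_of_consecutive hKN b.1 (fun κ => ∑ j : Fin (k + 1),
    (-1) ^ (j : ℕ) • column r W κ (s.incl (c j)) k b (j.removeNth c)) fun p hp => ?_) κ
  -- Database `b.1 + p` queries block `b` in position `p`. Arguments from the complement remove the
  -- side information.
  have h0 := DFunLike.congr_fun (congrFun (congrFun (h (b.1 + p)) k) (⟨p, hp⟩, b.2))
    fun j => s.incl (c j)
  rw [respond_apply] at h0
  rw [← interference_stored]
  refine Eq.trans (Finset.sum_congr rfl fun j _ => ?_) h0
  refine congrArg _ (Eq.trans ?_ (mix_incl par s _ _ k _ (j.removeNth c)).symm)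
  simp only [add_sub_cancel_right]
  rfl

/-- Re-encoding the recovered columns yields the interference at every database, including those
that do not query the block. -/
lemma interference_stored_eq_zero (hKN : K ≤ N) {G : Matrix (Fin K) (Fin N) F} (hG : IsMDS G)
    (par : Parents m K N a) (s : LineSplitting F (Fin m → F) v)
    (r : (Fin Lt → F) ≃ₗ[F] Symbols F m N a) (W : Messages F (m + 1) Lt K)
    (h : ∀ n, respond (mix par s n ∘ₗ r.toLinearMap) (stored G n W) = 0) (n : Fin N)
    (k : Fin (m + 1)) (b : Block N (a k)) (c : Fin (k + 1) → Fin m → F) :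
    ∑ j : Fin (k + 1), (-1) ^ (j : ℕ) •
      r (Matrix.vecMul (s.incl (c j)) (stored G n W)) k b (j.removeNth c) = 0 := by
  rw [interference_stored]
  exact Finset.sum_eq_zero fun κ _ => by
    rw [interference_eq_zero hKN hG par s r W h k b c κ, mul_zero]

/-- The part of an answer that is not the desired symbol is interference of the parent block. -/
lemma sum_mix_cons_eq_zero (hKN : K ≤ N) {G : Matrix (Fin K) (Fin N) F} (hG : IsMDS G)
    (par : Parents m K N a) (s : LineSplitting F (Fin m → F) v)
    (r : (Fin Lt → F) ≃ₗ[F] Symbols F m N a) (W : Messages F (m + 1) Lt K)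
    (h : ∀ n, respond (mix par s n ∘ₗ r.toLinearMap) (stored G n W) = 0) (n : Fin N)
    (k : Fin (m + 1)) (i : Slot K N (a k)) (c : Fin k → Fin m → F) :
    ∑ j : Fin k, (-1 : ℤ) ^ (j.succ : ℕ) • mix par s n
        (r (Matrix.vecMul (s.incl (c j)) (stored G n W))) k i
        (j.succ.removeNth (Fin.cons v fun j => s.incl (c j) : Fin (k + 1) → _)) = 0 := by
  obtain ⟨k, hk⟩ := k
  cases k with
  | zero => rfl
  | succ k =>
    have hz := interference_stored_eq_zero hKN hG par s r W h n ⟨k, (Nat.lt_succ_self k).trans hk⟩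
      (n - (par k hk i).1.1, (par k hk i).2) c
    -- Placing `v` first shifts every index by one, so the parent interference appears with the
    -- opposite sign.
    rw [← neg_eq_zero, ← hz, ← Finset.sum_neg_distrib]
    refine Finset.sum_congr rfl fun j _ => ?_
    have hrem : j.succ.removeNth (Fin.cons v fun j => s.incl (c j) : Fin (k + 1 + 1) → _) =
        (Fin.cons v fun l => s.incl (j.removeNth c l) : Fin (k + 1) → _) :=
      Fin.cons_comp_succ_succAbove _ _ _
    rw [hrem, Fin.val_succ, pow_succ, mul_neg_one, neg_smul, neg_neg]
    exact congrArg _ (mix_cons par s n _ k hk i (j.removeNth c))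

/-- If all answers vanish, so does the desired linear combination. -/
lemma linComb_eq_zero (hKN : K ≤ N) {G : Matrix (Fin K) (Fin N) F} (hG : IsMDS G)
    (par : Parents m K N a) (s : LineSplitting F (Fin m → F) v)
    (r : (Fin Lt → F) ≃ₗ[F] Symbols F m N a) (W : Messages F (m + 1) Lt K)
    (h : ∀ n, respond (mix par s n ∘ₗ r.toLinearMap) (stored G n W) = 0) : linComb v W = 0 := by
  have key : ∀ (k : Fin (m + 1)) (b : Block N (a k)) (c : Fin k → Fin m → F) (κ : Fin K),
      column r W κ v k b c = 0 := by
    intro k b c κ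
    refine congrFun (hG.eq_zero_of_consecutive hKN b.1 (fun κ => column r W κ v k b c)
      fun p hp => ?_) κ
    -- With `v` as first argument, the leading term is the desired coded symbol and the rest is
    -- parent interference.
    have h0 := DFunLike.congr_fun (congrFun (congrFun (h (b.1 + p)) k) (⟨p, hp⟩, b.2))
      (Fin.cons v fun j => s.incl (c j) : Fin (k + 1) → _)
    rw [respond_apply, Fin.sum_univ_succ] at h0
    have h1 : (mix par s (b.1 + p) ∘ₗ r.toLinearMap)
        (Matrix.vecMul v (stored G (b.1 + p) W)) k (⟨p, hp⟩, b.2) (fun j => s.incl (c j)) =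
        ∑ κ, G κ (b.1 + p) * column r W κ v k b c := by
      rw [LinearMap.comp_apply, LinearEquiv.coe_coe, vecMul_stored, mix_incl,
        sum_smul_symbols_apply]
      simp only [add_sub_cancel_right]
    have h2 := sum_mix_cons_eq_zero hKN hG par s r W h (b.1 + p) k (⟨p, hp⟩, b.2) c
    rw [← h1]
    have h3 := (congrArg₂ (· + ·) (one_smul ℤ _).symm h2.symm).trans h0
    rwa [add_zero] at h3
  have hcol : ∀ κ, column r W κ v = 0 := by
    intro κ
    funext k b
    exact AlternatingMap.ext fun c => key k b c κ
  funext t κ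
  have := congrFun (r.map_eq_zero_iff.1 (hcol κ)) t
  simpa [Matrix.vecMul, dotProduct, linComb] using this

end Decoding

/-! ### General facts about schemes -/

section Messages

variable {F : Type u} [Field F] {M N K Lt : ℕ}

lemma stored_sub (G : Matrix (Fin K) (Fin N) F) (n : Fin N) (W W' : Messages F M Lt K) :
    stored G n (W - W') = stored G n W - stored G n W' := by
  ext μ t
  simp [stored, mul_sub, Finset.sum_sub_distrib]

/-- `linComb` as an additive map of the messages. -/
def linCombHom (c : Fin M → F) : Messages F M Lt K →+ (Fin Lt → Fin K → F) where
  toFun := linComb c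
  map_zero' := by
    funext t k
    simp [linComb]
  map_add' W W' := by
    funext t k
    simp [linComb, mul_add, Finset.sum_add_distrib]

lemma linComb_surjective {c : Fin M → F} (hc : c ≠ 0) :
    Function.Surjective (linComb c : Messages F M Lt K → Fin Lt → Fin K → F) := by
  classical
  obtain ⟨μ, hμ⟩ := Function.ne_iff.1 hc
  intro x
  refine ⟨Pi.single μ ((c μ)⁻¹ • x), ?_⟩
  funext t k
  rw [linComb, Finset.sum_eq_single μ]
  · simp only [Pi.single_eq_same, Pi.smul_apply, smul_eq_mul]
    exact mul_inv_cancel_left₀ hμ _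
  · intro μ' _ h
    simp [h]
  · simp

lemma sum_uniform_messages [Fintype F] :
    ∑ _ω : Messages F M Lt K, (Fintype.card (Messages F M Lt K) : ℝ)⁻¹ = 1 := by
  simp

end Messages

namespace PFRScheme

variable {F : Type u} [Field F] [Fintype F] {M N K Lt V : ℕ} (S : PFRScheme F M N K Lt V)
  (G : Matrix (Fin K) (Fin N) F) (v : Fin V → Fin M → F)

lemma weight_mem_stdSimplex : S.weight ∈ stdSimplex ℝ S.Sample := by
  refine ⟨fun ω => mul_nonneg (S.law_mem.1 _) (by positivity), ?_⟩
  simp only [weight, Fintype.sum_prod_type, ← Finset.mul_sum, sum_uniform_messages, mul_one]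
  exact S.law_mem.2

lemma queriesIndependent : S.QueriesIndependent := fun ν =>
  mutualInfo_prod_eq_zero S.law_mem.2 sum_uniform_messages (S.query ν) (fun W => W)

lemma answersDetermined : S.AnswersDetermined G := fun _ n =>
  condEntropy_eq_zero_of_eq_comp _ _ _ (fun z => S.answer n z.1 z.2) fun _ => rfl

variable {S} in
/-- A scheme is private if, at each database, the queries for two indices are exchanged by a
law-preserving bijection of the private randomness. -/
lemma isPrivate_of_equiv (h : ∀ n ν ν', ∃ e : S.Rand ≃ S.Rand,
    ∀ r, S.law (e r) = S.law r ∧ S.query ν' (e r) n = S.query ν r n) : S.IsPrivate G := by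
  intro n μ hμ
  refine mutualInfo_index_eq_zero hμ.2 S.weight_mem_stdSimplex.2
    (fun ν ω => (S.A G ν n ω, S.Q ν n ω, stored G n ω.2)) fun ν ν' x => ?_
  obtain ⟨e, he⟩ := h n ν ν'
  refine prob_congr_equiv (e.prodCongr (Equiv.refl _)) _ _ _ _ (fun ω => ?_) (fun ω => ?_) x
  · simp [weight, (he ω.1).1]
  · simp [A, Q, (he ω.1).2]

lemma entropy_linComb {c : Fin M → F} (hc : c ≠ 0) :
    entropy S.weight (fun ω => linComb c ω.2) = (Lt * K : ℕ) * Real.log (Fintype.card F) := by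
  rw [entropy_eq_log_card S.weight (fun ω => linComb c ω.2) fun x =>
    (prob_snd S.law _ S.law_mem.2 (linComb c) x).trans
      (prob_addMonoidHom (linCombHom c) (linComb_surjective hc) x)]
  have : Fintype.card (Fin Lt → Fin K → F) = Fintype.card F ^ (Lt * K) := by
    simp [← pow_mul, mul_comm]
  rw [this, Nat.cast_pow, Real.log_pow]

variable {S G v}

lemma errorProb_eq_zero {ν : Fin V} (h : ∀ ω : S.Sample,
    S.decode ν (fun n => S.A G ν n ω) (fun n => S.Q ν n ω) = linComb (v ν) ω.2) :
    S.errorProb G v ν = 0 := by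
  rw [errorProb, prob_eq_sum_ite]
  simp [h]

lemma equivocation_eq_zero {ν : Fin V} (h : ∀ ω : S.Sample,
    S.decode ν (fun n => S.A G ν n ω) (fun n => S.Q ν n ω) = linComb (v ν) ω.2) :
    S.equivocation G v ν = 0 :=
  condEntropy_eq_zero_of_eq_comp _ _ _ (fun z => S.decode ν z.1 z.2) fun ω => (h ω).symm

/-- With error-free decoding and randomness of full support, some answer has positive entropy. -/
lemma sum_entropy_answers_pos (hlaw : ∀ r, 0 < S.law r) (hLK : 0 < Lt * K) {ν : Fin V}
    (hv : v ν ≠ 0) (h : ∀ ω : S.Sample,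
      S.decode ν (fun n => S.A G ν n ω) (fun n => S.Q ν n ω) = linComb (v ν) ω.2) :
    0 < ∑ n, entropy S.weight (S.A G ν n) := by
  have hnn : ∀ n ∈ Finset.univ, 0 ≤ entropy S.weight (S.A G ν n) :=
    fun n _ => entropy_nonneg S.weight_mem_stdSimplex _
  refine (Finset.sum_nonneg hnn).lt_of_ne fun h0 => ?_
  have hz := (Finset.sum_eq_zero_iff_of_nonneg hnn).1 h0.symm
  have hpos : ∀ ω, 0 < S.weight ω := fun ω => mul_pos (hlaw _) (by positivity)
  have hA : ∀ n ω₁ ω₂, S.A G ν n ω₁ = S.A G ν n ω₂ := fun n =>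
    eq_of_entropy_eq_zero S.weight_mem_stdSimplex hpos _ (hz n (Finset.mem_univ n))
  obtain ⟨r⟩ : Nonempty S.Rand := by
    by_contra hne
    rw [not_nonempty_iff] at hne
    simpa using S.law_mem.2
  -- Constant answers could not separate a combination equal to all ones from the zero combination.
  obtain ⟨W, hW⟩ := linComb_surjective (Lt := Lt) (K := K) hv (fun _ _ => 1)
  have h1 := h (r, W)
  have h2 := h (r, 0)
  have h3 : (fun n => S.A G ν n (r, W)) = fun n => S.A G ν n (r, 0) := funext fun n => hA n _ _
  rw [h3] at h1
  have h4 : linComb (v ν) W = linComb (v ν) (0 : Messages F M Lt K) := h1.symm.trans h2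
  rw [hW] at h4
  have h5 := congrFun (congrFun h4 ⟨0, Nat.pos_of_mul_pos_right hLK⟩)
    ⟨0, Nat.pos_of_mul_pos_left hLK⟩
  simp [linComb] at h5

end PFRScheme

/-! ### The scheme -/

section Scheme

variable {F : Type u} [Field F] [Fintype F] {m K N : ℕ} [NeZero N] {a : ℕ → ℕ}

instance finite_symbols : Finite (Symbols F m N a) := Module.finite_of_finite F

instance finite_coordinates (Lt : ℕ) : Finite ((Fin Lt → F) ≃ₗ[F] Symbols F m N a) :=
  DFunLike.finite _

instance fintype_coordinates (Lt : ℕ) : Fintype ((Fin Lt → F) ≃ₗ[F] Symbols F m N a) :=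
  Fintype.ofFinite _

instance fintype_answers : Fintype (Answers F m K N a) :=
  have : Finite (Answers F m K N a) := Module.finite_of_finite F
  Fintype.ofFinite _

open Classical in
/-- The retrieval scheme: the user draws uniform coordinates on the segments. -/
def retrievalScheme {Lt V : ℕ} [Nonempty ((Fin Lt → F) ≃ₗ[F] Symbols F m N a)]
    (G : Matrix (Fin K) (Fin N) F) (v : Fin V → Fin (m + 1) → F) (par : Parents m K N a)
    (s : ∀ ν, LineSplitting F (Fin m → F) (v ν)) : PFRScheme F (m + 1) N K Lt V where
  Rand := (Fin Lt → F) ≃ₗ[F] Symbols F m N a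
  law := fun _ => (Fintype.card ((Fin Lt → F) ≃ₗ[F] Symbols F m N a) : ℝ)⁻¹
  law_mem := ⟨fun _ => by positivity, by simp⟩
  Query := (Fin Lt → F) →ₗ[F] Extract F m K N a
  Answer := Answers F m K N a
  query ν r n := mix par (s ν) n ∘ₗ r.toLinearMap
  answer _ P X := respond P X
  decode ν ans qs :=
    -- Any consistent messages will do: the answers fix the desired combination, though not the
    -- messages.
    if h : ∃ W, ∀ n, respond (qs n) (stored G n W) = ans n then linComb (v ν) h.choose else 0

variable {Lt V : ℕ} [Nonempty ((Fin Lt → F) ≃ₗ[F] Symbols F m N a)]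
  {G : Matrix (Fin K) (Fin N) F} {v : Fin V → Fin (m + 1) → F} (par : Parents m K N a)
  (s : ∀ ν, LineSplitting F (Fin m → F) (v ν))

lemma retrievalScheme_decode (hKN : K ≤ N) (hG : IsMDS G) (ν : Fin V)
    (ω : (retrievalScheme (Lt := Lt) G v par s).Sample) :
    (retrievalScheme G v par s).decode ν (fun n => (retrievalScheme G v par s).A G ν n ω)
      (fun n => (retrievalScheme G v par s).Q ν n ω) = linComb (v ν) ω.2 := by
  obtain ⟨r, W⟩ := ω
  have hex : ∃ W', ∀ n, respond (mix par (s ν) n ∘ₗ r.toLinearMap) (stored G n W') =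
      respond (mix par (s ν) n ∘ₗ r.toLinearMap) (stored G n W) := ⟨W, fun n => rfl⟩
  refine (dif_pos hex).trans ?_
  have h0 := linComb_eq_zero hKN hG par (s ν) r (hex.choose - W) fun n => by
    rw [stored_sub, respond_sub, hex.choose_spec n, sub_self]
  exact sub_eq_zero.1 ((map_sub (linCombHom (v ν)) hex.choose W).symm.trans h0)

lemma retrievalScheme_isPrivate : (retrievalScheme (Lt := Lt) G v par s).IsPrivate G := by
  refine PFRScheme.isPrivate_of_equiv G fun n ν ν' => ?_
  obtain ⟨e, he⟩ := exists_equiv_comp_eq (mix par (s ν') n) (mix par (s ν) n)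
    (mix_surjective par (s ν') n) (mix_surjective par (s ν) n)
  refine ⟨⟨fun r => r.trans e, fun r => r.trans e.symm, fun r => ?_, fun r => ?_⟩, fun r =>
    ⟨rfl, ?_⟩⟩
  · exact LinearEquiv.ext fun x => e.symm_apply_apply _
  · exact LinearEquiv.ext fun x => e.apply_symm_apply _
  · exact LinearMap.ext fun x => LinearMap.congr_fun he
      ((show (Fin Lt → F) ≃ₗ[F] Symbols F m N a from r) x)

lemma retrievalScheme_rate (hKN : K ≤ N) (hG : IsMDS G) (hLK : 0 < Lt * K) (ν : Fin V)
    (hv : v ν ≠ 0) :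
    ((Lt * K : ℕ) : ℝ) / (N * Module.finrank F (Answers F m K N a) : ℕ) ≤
      (retrievalScheme (Lt := Lt) G v par s).rate G v ν := by
  set S := retrievalScheme (Lt := Lt) G v par s
  -- Positivity matters: division by `0` would make the rate `0`.
  have hpos : 0 < ∑ n, entropy S.weight (S.A G ν n) :=
    PFRScheme.sum_entropy_answers_pos (fun r => inv_pos.2 (by exact_mod_cast Fintype.card_pos))
      hLK hv fun ω => retrievalScheme_decode par s hKN hG ν ω
  have hlog : 0 < Real.log (Fintype.card F) :=
    Real.log_pos (by exact_mod_cast Fintype.one_lt_card)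
  have hle : ∑ n, entropy S.weight (S.A G ν n) ≤
      (N * Module.finrank F (Answers F m K N a) : ℕ) * Real.log (Fintype.card F) := by
    have h1 : ∀ n ∈ Finset.univ, entropy S.weight (S.A G ν n) ≤
        Module.finrank F (Answers F m K N a) * Real.log (Fintype.card F) := by
      intro n _
      rw [← Real.log_pow, ← Nat.cast_pow, ← Module.card_eq_pow_finrank]
      exact entropy_le_log_card (α := Answers F m K N a) S.weight_mem_stdSimplex (S.A G ν n)
    refine (Finset.sum_le_sum h1).trans (le_of_eq ?_)
    simp [mul_assoc]
  rw [PFRScheme.rate, S.entropy_linComb hv, ← mul_div_mul_right _ _ hlog.ne']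
  gcongr

end Scheme

/-! ### Sizes -/

section Sizes

/-- Multiplied by `y`, both sides become `(x + y)^(m+1) - x^(m+1)`; induction with Pascal's rule
avoids the division. -/
lemma sum_choose_succ_mul (x y m : ℕ) :
    ∑ k ∈ Finset.range (m + 1), (m + 1).choose (k + 1) * (x ^ (m - k) * y ^ k) =
      ∑ i ∈ Finset.range (m + 1), (y + x) ^ (m - i) * x ^ i := by
  induction m with
  | zero => simp
  | succ m ih =>
    have h1 : ∀ k ∈ Finset.range (m + 1 + 1),
        (m + 1 + 1).choose (k + 1) * (x ^ (m + 1 - k) * y ^ k) =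
          y ^ k * x ^ (m + 1 - k) * (m + 1).choose k +
            (m + 1).choose (k + 1) * (x ^ (m + 1 - k) * y ^ k) := by
      intro k _
      rw [Nat.choose_succ_succ' (m + 1) k]
      ring
    have h0 := add_pow y x (m + 1)
    simp only [Nat.cast_id] at h0
    rw [Finset.sum_congr rfl h1, Finset.sum_add_distrib, ← h0]
    rw [Finset.sum_range_succ _ (m + 1), Nat.choose_succ_self, zero_mul, add_zero]
    rw [Finset.sum_range_succ' _ (m + 1), pow_zero, mul_one, Nat.sub_zero, add_comm]
    congr 1
    have h2 : ∀ k ∈ Finset.range (m + 1), (m + 1).choose (k + 1) * (x ^ (m + 1 - k) * y ^ k) =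
        x * ((m + 1).choose (k + 1) * (x ^ (m - k) * y ^ k)) := by
      intro k hk
      have : m + 1 - k = (m - k) + 1 := by
        have := Finset.mem_range.1 hk
        omega
      rw [this, pow_succ]
      ring
    rw [Finset.sum_congr rfl h2, ← Finset.mul_sum, ih, Finset.mul_sum]
    refine Finset.sum_congr rfl fun i _ => ?_
    rw [Nat.add_sub_add_right, pow_succ x i]
    ring

/-- The number of blocks with the same cyclic position at level `k`. -/
def blockCount (m K N J k : ℕ) : ℕ := J * (K ^ (m - k) * (N - K) ^ k)

lemma card_fin_lt {K N : ℕ} (hKN : K ≤ N) : Fintype.card {p : Fin N // p.val < K} = K := by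
  rw [Fintype.card_subtype, Fin.card_filter_val_lt, min_eq_right hKN]

/-- The block counts `a k` are chosen so that `K * a (k + 1) = (N - K) * a k`: every side slot below
the top level is used exactly once. -/
lemma nonempty_parents {m K N : ℕ} (hKN : K ≤ N) (J : ℕ) :
    Nonempty (Parents m K N (blockCount m K N J)) := by
  have h : ∀ k (_ : k + 1 < m + 1), Nonempty (Slot K N (blockCount m K N J (k + 1)) ↪
      SideSlot K N (blockCount m K N J k)) := by
    intro k hk
    refine Function.Embedding.nonempty_of_card_le (le_of_eq ?_)
    rw [Fintype.card_prod, Fintype.card_prod, card_fin_lt hKN, Fintype.card_subtype_compl,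
      card_fin_lt hKN, Fintype.card_fin, Fintype.card_fin, Fintype.card_fin, blockCount, blockCount]
    have : m - k = m - (k + 1) + 1 := by omega
    rw [this, pow_succ, pow_succ]
    ring
  exact ⟨fun k hk => (h k hk).some⟩

variable (F : Type u) [Field F]

lemma finrank_symbols {m K N : ℕ} (hKN : K ≤ N) (J : ℕ) :
    Module.finrank F (Symbols F m N (blockCount m K N J)) = J * N ^ (m + 1) := by
  simp only [Module.finrank_pi_fintype, finrank_alternatingForms, Finset.sum_const,
    Finset.card_univ, Fintype.card_prod, Fintype.card_fin, smul_eq_mul, Module.finrank_self, mul_one]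
  rw [Fin.sum_univ_eq_sum_range fun k => N * blockCount m K N J k * m.choose k]
  have h0 := add_pow (N - K) K m
  simp only [Nat.cast_id, Nat.sub_add_cancel hKN] at h0
  rw [pow_succ, h0, Finset.sum_mul, Finset.mul_sum]
  refine Finset.sum_congr rfl fun k _ => ?_
  rw [blockCount]
  ring

lemma finrank_answers {m K N : ℕ} (hKN : K ≤ N) (J : ℕ) :
    Module.finrank F (Answers F m K N (blockCount m K N J)) =
      J * K * ∑ i ∈ Finset.range (m + 1), N ^ (m - i) * K ^ i := by
  simp only [Module.finrank_pi_fintype, finrank_alternatingForms, Finset.sum_const,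
    Finset.card_univ, Fintype.card_prod, Fintype.card_fin, card_fin_lt hKN, smul_eq_mul,
    Module.finrank_self, mul_one]
  rw [Fin.sum_univ_eq_sum_range fun k => K * blockCount m K N J k * (m + 1).choose (k + 1)]
  have h := sum_choose_succ_mul K (N - K) m
  rw [Nat.sub_add_cancel hKN] at h
  rw [← h, Finset.mul_sum]
  refine Finset.sum_congr rfl fun k _ => ?_
  rw [blockCount]
  ring

lemma inv_geom_sum_eq {m K N : ℕ} (hN : 0 < N) :
    (∑ i ∈ Finset.range (m + 1), ((K : ℝ) / N) ^ i)⁻¹ =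
      (N : ℝ) ^ m / (∑ i ∈ Finset.range (m + 1), N ^ (m - i) * K ^ i : ℕ) := by
  have hN' : (N : ℝ) ≠ 0 := by positivity
  rw [← inv_div (_ : ℝ) ((N : ℝ) ^ m)]
  congr 1
  rw [Nat.cast_sum, Finset.sum_div]
  refine Finset.sum_congr rfl fun i hi => ?_
  have : m = (m - i) + i := by
    have := Finset.mem_range.1 hi
    omega
  rw [div_pow, eq_div_iff (by positivity)]
  conv_lhs => rw [this]
  push_cast
  rw [pow_add]
  field_simp

end Sizes

/-- The MDS-coded capacity expression is an achievable rate. -/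
lemma isAchievableRate_of_le {F : Type u} [Field F] [Fintype F] {m N K V : ℕ} (hK : 1 ≤ K)
    (hKN : K ≤ N) (G : Matrix (Fin K) (Fin N) F) (hG : IsMDS G) (v : Fin V → Fin (m + 1) → F)
    (hv : ∀ ν, v ν ≠ 0) {R : ℝ} (hR : R ≤ (∑ i ∈ Finset.range (m + 1), ((K : ℝ) / N) ^ i)⁻¹) :
    IsAchievableRate G v R := by
  have hN : 0 < N := by omega
  have : NeZero N := ⟨hN.ne'⟩
  -- The multiplicity `j + 1` keeps the length positive and makes it grow; it cancels in the rate.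
  have par : ∀ j, Parents m K N (blockCount m K N (j + 1)) := fun j =>
    (nonempty_parents hKN (j + 1)).some
  have s : ∀ ν, LineSplitting F (Fin m → F) (v ν) := fun ν =>
    (exists_lineSplitting (by simp) (hv ν)).some
  have hne : ∀ j : ℕ, Nonempty ((Fin ((j + 1) * N ^ (m + 1)) → F) ≃ₗ[F]
      Symbols F m N (blockCount m K N (j + 1))) := fun j =>
    ⟨LinearEquiv.ofFinrankEq _ _ (by rw [finrank_symbols F hKN, Module.finrank_fin_fun])⟩
  have hdec := fun j => retrievalScheme_decode (Lt := (j + 1) * N ^ (m + 1)) (par j) s hKN hG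
  refine ⟨fun j => (j + 1) * N ^ (m + 1), fun j => retrievalScheme G v (par j) s, ?_,
    fun j => ⟨PFRScheme.queriesIndependent _, PFRScheme.answersDetermined _ G,
      retrievalScheme_isPrivate (par j) s⟩, fun ν => ?_, fun ν => ?_, fun j ν => ?_⟩
  · refine tendsto_atTop_mono (fun j => ?_) tendsto_id
    have h1 : 0 < N ^ (m + 1) * K := by positivity
    rw [mul_assoc]
    exact (Nat.le_succ j).trans (Nat.le_mul_of_pos_right _ h1)
  · simp only [PFRScheme.errorProb_eq_zero (hdec _ ν), tendsto_const_nhds]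
  · simp only [PFRScheme.equivocation_eq_zero (hdec _ ν)]
    exact isLittleO_zero _ _
  · have hLK : 0 < (j + 1) * N ^ (m + 1) * K := by positivity
    refine (hR.trans (le_of_eq ?_)).trans
      (retrievalScheme_rate (par j) s hKN hG hLK ν (hv ν))
    rw [inv_geom_sum_eq hN, finrank_answers F hKN]
    have hE : 0 < ∑ i ∈ Finset.range (m + 1), N ^ (m - i) * K ^ i :=
      Finset.sum_pos (fun i _ => by positivity) (by simp)
    have hE' : ((∑ i ∈ Finset.range (m + 1), N ^ (m - i) * K ^ i : ℕ) : ℝ) ≠ 0 := by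
      exact_mod_cast hE.ne'
    generalize ∑ i ∈ Finset.range (m + 1), N ^ (m - i) * K ^ i = E at hE hE'
    have hN' : (N : ℝ) ≠ 0 := by positivity
    have hK' : (K : ℝ) ≠ 0 := by positivity
    have hj : (j : ℝ) + 1 ≠ 0 := by positivity
    push_cast
    field_simp
    ring

theorem theorem1 {F : Type u} [Field F] [Fintype F] {M N K V : ℕ}
    (hM : 1 ≤ M) (hK : 1 ≤ K) (hKN : K ≤ N)
    (G : Matrix (Fin K) (Fin N) F) (hG : IsMDS G)
    (v : Fin V → Fin M → F) (hv : IsCoeffSystem v) :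
    (∀ R : ℝ, R ≤ (∑ i ∈ Finset.range M, ((K : ℝ) / N) ^ i)⁻¹ → IsAchievableRate G v R) ∧
    (K < N →
      (1 - (K : ℝ) / N) / (1 - ((K : ℝ) / N) ^ M)
        = (∑ i ∈ Finset.range M, ((K : ℝ) / N) ^ i)⁻¹) := by
  obtain ⟨m, rfl⟩ : ∃ m, M = m + 1 := ⟨M - 1, by omega⟩
  refine ⟨fun R hR => isAchievableRate_of_le hK hKN G hG v hv.2.1 hR, fun hlt => ?_⟩
  have hN : (0 : ℝ) < N := by
    exact_mod_cast (show 0 < N by omega)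
  have hx : (K : ℝ) / N < 1 := by
    rw [div_lt_one hN]
    exact_mod_cast hlt
  rw [geom_sum_eq hx.ne, inv_div, ← neg_sub, ← neg_sub (((K : ℝ) / N) ^ (m + 1)) 1, neg_div_neg_eq]

end
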